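/- Let $h\ge 1$, $r\ge 0$ be integers and let $\boldsymbol d=(d_0,\dots,d_h)$ be a sequence of nonnegative integers. For $\theta=(W_h,\dots,W_1)\in\mathbb R^{d_\theta}$, with $W_i\in\mathbb R^{d_i\times d_{i-1}}$ and $d_\theta=\sum_{i=1}^h d_id_{i-1}$, let $$p_\theta(x)=W_h\,\rho_r\,W_{h-1}\,\rho_r\cdots\rho_r\,W_1x ,\qquad x=(x_1,\dots,x_{d_0}),$$ where $\rho_r$ raises every entry of a vector to the $r$-th power (with $f^0=1$). Each entry of $p_\theta$ is a homogeneous polynomial of degree $r^{h-1}$ in $x_1,\dots,x_{d_0}$, so that $p_\theta$ lies in the real vector space $\mathrm{Sym}_{r^{h-1}}(\mathbb R^{d_0})^{d_h}$ of $d_h$-tuples of such polynomials, which is identified with a space $\mathbb R^N$ by taking all coefficients. Let $\Phi_{\boldsymbol d,r}:\mathbb R^{d_\theta}\to \mathrm{Sym}_{r^{h-1}}(\mathbb R^{d_0})^{d_h}$, $\theta\mapsto p_\theta$; let $\mathcal V_{\boldsymbol d,r}$ be the Zariski closure of its image (the smallest set that contains the image and is the common zero set of real polynomials), and let $\dim\mathcal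 V_{\boldsymbol d,r}$ be its dimension as an algebraic variety, i.e. the Krull dimension of its ring of real polynomial functions. Let $\mathrm{Jac}\,\Phi_{\boldsymbol d,r}(\theta)$ be the $N\times d_\theta$ matrix of partial derivatives at $\theta$ of the coefficients of $p_\theta$ with respect to the entries of the weight matrices. Then $$\operatorname{rank}\,\mathrm{Jac}\,\Phi_{\boldsymbol d,r}(\theta)\le\dim\mathcal V_{\boldsymbol d,r}\qquad\text{for all }\theta\in\mathbb R^{d_\theta},$$ and there is a nonempty Zariski-open subset $U\subseteq\mathbb R^{d_\theta}$ such that $\operatorname{rank}\,\mathrm{Jac}\,\Phi_{\boldsymbol d,r}(\theta)=\dim\mathcal V_{\boldsymbol d,r}$ for all $\theta\in U$. -/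

import Mathlib

namespace PolyNet

open MvPolynomial

noncomputable section

/-- Index set of the weights of a network of depth `h` with widths `d 0, …, d h`: the entries of
matrices `W_{i+1}` of size `d (i+1) × d i` for `i = 0, …, h - 1`. -/
abbrev WeightIndex {h : ℕ} (d : Fin (h + 1) → ℕ) : Type :=
  Σ i : Fin h, Fin (d i.succ) × Fin (d i.castSucc)

/-- The parameter space `ℝ^{d_θ}`. -/
abbrev Params {h : ℕ} (d : Fin (h + 1) → ℕ) : Type := WeightIndex d → ℝ

/-- The weight matrix `W_{i+1}` of the parameter `θ`. -/
def weight {h : ℕ} {d : Fin (h + 1) → ℕ} (θ : Params d) (i : Fin h) :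
    Matrix (Fin (d i.succ)) (Fin (d i.castSucc)) ℝ :=
  Matrix.of fun a b => θ ⟨i, a, b⟩

/-- The entrywise activation `ρ_r`, raising every entry to the `r`-th power. -/
def activation {R : Type*} [Monoid R] {n : ℕ} (r : ℕ) (z : Fin n → R) : Fin n → R :=
  fun a => z a ^ r

/-- The values at the `i`-th layer, before activation, as polynomials in the input variables
`x = (x_1, …, x_{d 0})`: layer `0` is `x`, layer `1` is `W_1 x`, and
layer `i + 1` is `W_{i+1} ρ_r (layer i)` for `i ≥ 1`. -/
def layer {h : ℕ} {d : Fin (h + 1) → ℕ} (r : ℕ) (θ : Params d) :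
    (i : Fin (h + 1)) → Fin (d i) → MvPolynomial (Fin (d 0)) ℝ :=
  Fin.induction (motive := fun i => Fin (d i) → MvPolynomial (Fin (d 0)) ℝ)
    (fun a => X a)
    (fun i z => ((weight θ i).map C).mulVec (if (i : ℕ) = 0 then z else activation r z))

/-- The network `p_θ = W_h ρ_r W_{h-1} ρ_r … ρ_r W_1 x`, a vector of `d_h` polynomials. -/
def network {h : ℕ} {d : Fin (h + 1) → ℕ} (r : ℕ) (θ : Params d) :
    Fin (d (Fin.last h)) → MvPolynomial (Fin (d 0)) ℝ :=
  layer r θ (Fin.last h)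

theorem layer_isHomogeneous {h : ℕ} {d : Fin (h + 1) → ℕ} (r : ℕ) (θ : Params d)
    (i : Fin (h + 1)) : ∀ a, (layer r θ i a).IsHomogeneous (r ^ ((i : ℕ) - 1)) := by
  induction i using Fin.induction with
  | zero =>
    intro a
    simpa [layer] using isHomogeneous_X ℝ a
  | succ i ih =>
    intro a
    have key : layer r θ i.succ = ((weight θ i).map C).mulVec
        (if (i : ℕ) = 0 then layer r θ i.castSucc else activation r (layer r θ i.castSucc)) := by
      simp [layer]
    rw [key]
    simp only [Matrix.mulVec, dotProduct, Matrix.map_apply]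
    refine IsHomogeneous.sum _ _ _ fun b _ => IsHomogeneous.C_mul ?_ _
    split_ifs with hi
    · simpa [hi] using ih b
    · have := (ih b).pow r
      rw [Fin.val_castSucc, ← pow_succ] at this
      have e : (i : ℕ) - 1 + 1 = (i.succ : ℕ) - 1 := by
        rw [Fin.val_succ]; omega
      rwa [e] at this

/-- `Sym_D(ℝⁿ)`: homogeneous polynomials of degree `D` in `n` variables. -/
abbrev HomPoly (n D : ℕ) : Type := homogeneousSubmodule (Fin n) ℝ D

/-- The exponents of the monomials of degree `D` in `n` variables. -/
abbrev Exponent (n D : ℕ) : Type := {α : Fin n →₀ ℕ // α.degree = D}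

instance (n D : ℕ) : Fintype (Exponent n D) :=
  Fintype.subtype (Finset.finsuppAntidiag Finset.univ D) (by
    intro α
    simp [Finset.mem_finsuppAntidiag, Finsupp.degree_eq_sum])

/-- Coordinates on `Sym_D(ℝⁿ)^k` with respect to the monomial basis, i.e. the identification of
a `k`-tuple of forms with the vector of all its coefficients. -/
def coords (k n D : ℕ) : (Fin k → HomPoly n D) ≃ₗ[ℝ] (Fin k × Exponent n D → ℝ) where
  toFun p j := coeff (j.2 : Fin n →₀ ℕ) (p j.1 : MvPolynomial (Fin n) ℝ)
  invFun c a := ⟨∑ α : Exponent n D, monomial (α : Fin n →₀ ℕ) (c (a, α)),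
    (mem_homogeneousSubmodule _ _).2 <|
      IsHomogeneous.sum _ _ _ fun α _ => isHomogeneous_monomial _ α.2⟩
  map_add' p q := by ext j; simp
  map_smul' t p := by ext j; simp
  left_inv p := by
    funext a
    ext β
    simp only [coeff_sum, coeff_monomial]
    by_cases hβ : β.degree = D
    · rw [Finset.sum_eq_single (⟨β, hβ⟩ : Exponent n D)]
      · simp
      · intro α _ hα
        exact if_neg fun e => hα (Subtype.ext e)
      · simp
    · rw [Finset.sum_eq_zero]
      · exact (((mem_homogeneousSubmodule _ _).1 (p a).2).coeff_eq_zero hβ).symm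
      · intro α _
        exact if_neg fun e => hβ (by rw [← e]; exact α.2)
  right_inv c := by
    ext ⟨a, β⟩
    simp only [coeff_sum, coeff_monomial]
    rw [Finset.sum_eq_single β]
    · simp
    · intro α _ hα
      exact if_neg fun e => hα (Subtype.ext e)
    · simp

/-- The ambient space `Sym_{r^{h-1}}(ℝ^{d_0})^{d_h}`. -/
abbrev Ambient {h : ℕ} (d : Fin (h + 1) → ℕ) (r : ℕ) : Type :=
  Fin (d (Fin.last h)) → HomPoly (d 0) (r ^ (h - 1))

/-- The map `Φ_{d,r} : θ ↦ p_θ`. -/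
def Phi {h : ℕ} (d : Fin (h + 1) → ℕ) (r : ℕ) (θ : Params d) : Ambient d r :=
  fun a => ⟨network r θ a, (mem_homogeneousSubmodule _ _).2
    (by simpa [network] using layer_isHomogeneous r θ (Fin.last h) a)⟩

/-- The coordinate index set of the ambient space: an output and a monomial. -/
abbrev CoordIndex {h : ℕ} (d : Fin (h + 1) → ℕ) (r : ℕ) : Type :=
  Fin (d (Fin.last h)) × Exponent (d 0) (r ^ (h - 1))

/-- The monomial coordinates on the ambient space. -/
def ambientCoords {h : ℕ} (d : Fin (h + 1) → ℕ) (r : ℕ) :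
    Ambient d r ≃ₗ[ℝ] (CoordIndex d r → ℝ) :=
  coords (d (Fin.last h)) (d 0) (r ^ (h - 1))

/-- The Jacobian matrix of `Φ_{d,r}` at `θ`: the partial derivatives of the coefficients of `p_θ`
with respect to the weights. -/
def jacobian {h : ℕ} (d : Fin (h + 1) → ℕ) (r : ℕ) (θ : Params d) :
    Matrix (CoordIndex d r) (WeightIndex d) ℝ :=
  Matrix.of fun j e =>
    deriv (fun t : ℝ => ambientCoords d r (Phi d r (Function.update θ e t)) j) (θ e)

/-- A subset of `ℝ^σ` is Zariski closed if it is the set of common zeros of some polynomials. -/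
def IsZariskiClosed {σ : Type*} (S : Set (σ → ℝ)) : Prop :=
  ∃ P : Set (MvPolynomial σ ℝ), S = {x | ∀ p ∈ P, eval x p = 0}

/-- A subset of `ℝ^σ` is Zariski open if its complement is Zariski closed. -/
def IsZariskiOpen {σ : Type*} (S : Set (σ → ℝ)) : Prop := IsZariskiClosed Sᶜ

/-- The Zariski closure: the smallest Zariski closed set containing `S`. -/
def zariskiClosure {σ : Type*} (S : Set (σ → ℝ)) : Set (σ → ℝ) :=
  ⋂₀ {T | IsZariskiClosed T ∧ S ⊆ T}

/-- The dimension of a real algebraic set: the Krull dimension of its ring of polynomial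
functions. -/
def algDim {σ : Type*} (S : Set (σ → ℝ)) : WithBot ℕ∞ :=
  ringKrullDim (MvPolynomial σ ℝ ⧸ vanishingIdeal ℝ S)

/-- The functional space `F_{d,r}`, the image of `Φ_{d,r}`. -/
def functionalSpace {h : ℕ} (d : Fin (h + 1) → ℕ) (r : ℕ) : Set (Ambient d r) :=
  Set.range (Phi d r)

/-- The functional variety `V_{d,r}`: the Zariski closure of the functional space in
`Sym_{r^{h-1}}(ℝ^{d_0})^{d_h}`, written in monomial coordinates. -/
def functionalVariety {h : ℕ} (d : Fin (h + 1) → ℕ) (r : ℕ) : Set (CoordIndex d r → ℝ) :=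
  zariskiClosure (ambientCoords d r '' functionalSpace d r)

end

end PolyNet

/-! The statement holds for every polynomial map `F` between real affine spaces; of the network only
the fact that its coefficients are polynomials in the weights is used. The coordinate ring of the
closure of the image is the algebra generated by the components of `F`, a finitely generated domain,
so its Krull dimension is its transcendence degree: the largest number of algebraically independent
components. In characteristic zero independence is detected by minors of the symbolic Jacobian
(`algebraicIndependent_of_det_pderiv_ne_zero`, `exists_det_pderiv_ne_zero_of_algebraicIndependent`).
A minor nonzero at one point is a nonzero polynomial, which bounds the rank; one maximal nonzero
minor cuts out `U`. -/

namespace PolyNet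

open MvPolynomial

/-! ### Krull dimension and transcendence degree -/

section KrullDimension

/-- Incomparability makes contraction of primes strictly monotone, giving `≤`. Lying over, which
uses injectivity, and going up lift every chain, giving `≥`. -/
theorem ringKrullDim_eq_of_isIntegral_of_injective {R S : Type*} [CommRing R] [CommRing S]
    (f : R →+* S) (hf : f.IsIntegral) (hinj : Function.Injective f) :
    ringKrullDim S = ringKrullDim R := by
  algebraize [f]
  have hint : Algebra.IsIntegral R S := ⟨hf⟩
  apply le_antisymm
  · refine Order.krullDim_le_of_strictMono (PrimeSpectrum.comap (algebraMap R S)) ?_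
    intro p q hpq
    exact Ideal.IsIntegral.comap_lt_comap hpq
  · refine iSup_le fun l => ?_
    obtain ⟨Q, -, hQ, hQl⟩ := Ideal.exists_ideal_over_prime_of_isIntegral (S := S)
      l.head.asIdeal ⊥ (by
        rw [← RingHom.ker_eq_comap_bot, (RingHom.injective_iff_ker_eq_bot (algebraMap R S)).1 hinj]
        exact bot_le)
    have : Q.LiesOver l.head.asIdeal := ⟨hQl.symm⟩
    obtain ⟨L, hL, -⟩ := Ideal.exists_ltSeries_of_hasGoingUp l Q
    rw [← hL]
    exact Order.LTSeries.length_le_krullDim L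

/-- The Krull dimension of a finitely generated domain over a field is its transcendence
degree. -/
theorem exists_ringKrullDim_eq_and_trdeg_eq (k A : Type*) [Field k] [CommRing A] [IsDomain A]
    [Algebra k A] [Algebra.FiniteType k A] :
    ∃ n : ℕ, ringKrullDim A = n ∧ Algebra.trdeg k A = n := by
  obtain ⟨n, g, hinj, hint⟩ := exists_integral_inj_algHom_of_fg k A
  refine ⟨n, ?_, ?_⟩
  · rw [ringKrullDim_eq_of_isIntegral_of_injective g.toRingHom hint hinj]
    simp
  · algebraize [g.toRingHom]
    have : IsScalarTower k (MvPolynomial (Fin n) k) A := .of_algHom g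
    have : Algebra.IsIntegral (MvPolynomial (Fin n) k) A := ⟨hint⟩
    have : FaithfulSMul (MvPolynomial (Fin n) k) A :=
      (faithfulSMul_iff_algebraMap_injective _ _).2 hinj
    have key := (IsTranscendenceBasis.mvPolynomial (Fin n) k).algebraMap_comp (A := A)
    simpa using key.lift_cardinalMk_eq_trdeg.symm

end KrullDimension

/-! ### Derivations and algebraic independence -/

section Derivation

variable {k : Type*} [Field k]

/-- The chain rule for a derivation applied to a polynomial expression. -/
theorem derivation_aeval {A M κ : Type*} [CommRing A] [Algebra k A] [AddCommGroup M] [Module A M]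
    [Module k M] [IsScalarTower k A M] [Fintype κ] (D : Derivation k A M) (f : κ → A)
    (p : MvPolynomial κ k) :
    D (aeval f p) = ∑ j, aeval f (pderiv j p) • D (f j) := by
  classical
  induction p using MvPolynomial.induction_on with
  | C a => simp [← algebraMap_eq]
  | add p q hp hq => simp [hp, hq, add_smul, Finset.sum_add_distrib]
  | mul_X p i hp =>
    simp only [map_mul, aeval_X, Derivation.leibniz, hp, smul_eq_mul, map_add, add_smul,
      Finset.sum_add_distrib, Finset.smul_sum, pderiv_X, Pi.single_apply, mul_smul]
    congr 1
    rw [Finset.sum_eq_single i]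
    · simp
    · intro j _ hj
      simp [hj.symm]
    · simp

/-- The nonvanishing hypothesis matters at `n = 0`: the zero polynomial has total degree `0`. -/
theorem totalDegree_pderiv_lt {κ : Type*} {p : MvPolynomial κ k} {n : ℕ}
    (hp : p.totalDegree < n + 1) (j : κ) (h : pderiv j p ≠ 0) :
    (pderiv j p).totalDegree < n := by
  obtain ⟨m, hm, hmax⟩ := (pderiv j p).support.exists_mem_eq_sup (support_nonempty.2 h)
    (fun s => s.sum fun _ e => e)
  have h1 : (pderiv j p).totalDegree = m.degree := hmax
  rw [mem_support_iff, coeff_pderiv] at hm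
  have h2 := le_totalDegree (mem_support_iff.2 (left_ne_zero_of_mul hm))
  have h3 : ((m + Finsupp.single j 1).sum fun _ e => e) = m.degree + 1 := by
    change (m + Finsupp.single j 1).degree = _
    simp
  omega

theorem eq_C_of_forall_pderiv_eq_zero [CharZero k] {κ : Type*} {p : MvPolynomial κ k}
    (h : ∀ j, pderiv j p = 0) : p = C (coeff 0 p) := by
  classical
  ext m
  rw [coeff_C]
  split_ifs with hm
  · rw [hm]
  · obtain ⟨j, hj⟩ : ∃ j, m j ≠ 0 := by
      by_contra! hc
      exact hm (Finsupp.ext fun j => (hc j).symm)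
    have hle : Finsupp.single j 1 ≤ m := by
      rw [Finsupp.single_le_iff]
      omega
    have := coeff_pderiv (i := j) p (m - Finsupp.single j 1)
    rw [h j, coeff_zero, tsub_add_cancel_of_le hle] at this
    rcases mul_eq_zero.1 this.symm with h0 | h0
    · exact h0
    · exact absurd h0 (Nat.cast_add_one_ne_zero _)

/-- Polynomials whose Jacobian matrix has a nonvanishing maximal minor are algebraically
independent. -/
theorem algebraicIndependent_of_det_pderiv_ne_zero [CharZero k] {σ κ : Type*} [Fintype κ]
    [DecidableEq κ] (f : κ → MvPolynomial σ k) (c : κ → σ)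
    (hdet : (Matrix.of fun a b => pderiv (c b) (f a)).det ≠ 0) :
    AlgebraicIndependent k f := by
  rw [algebraicIndependent_iff]
  suffices H : ∀ n (p : MvPolynomial κ k), p.totalDegree < n → aeval f p = 0 → p = 0 from
    fun p => H _ p (Nat.lt_succ_self _)
  intro n
  induction n with
  | zero => intro p hp; omega
  | succ n ih =>
    intro p hp h0
    -- Differentiating the relation `p(f) = 0` gives a row vector killed by the Jacobian, so each
    -- partial derivative of `p` is a relation of smaller degree.
    have hzero : (fun a => aeval f (pderiv a p)) = 0 := by
      by_contra hne
      refine hdet (Matrix.exists_vecMul_eq_zero_iff.1 ⟨_, hne, ?_⟩)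
      ext1 b
      have := derivation_aeval (pderiv (c b)) f p
      rw [h0, map_zero] at this
      simpa [Matrix.vecMul, dotProduct] using this.symm
    have hC := eq_C_of_forall_pderiv_eq_zero (p := p) fun j => by
      by_contra hne
      exact hne (ih _ (totalDegree_pderiv_lt hp j hne) (congrFun hzero j))
    rw [hC, ← algebraMap_eq, AlgHom.commutes, algebraMap_eq, C_eq_zero] at h0
    rw [hC, h0, C_0]

/-- If `p(a) = 0` then `p'(a) • D a = 0`, so either `D a = 0` or `p'` is a relation of smaller
degree. The descent stops since a nonzero constant does not annihilate. -/
theorem derivation_eq_zero_of_isAlgebraic [CharZero k] {A M : Type*} [CommRing A] [IsDomain A]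
    [Algebra k A] [AddCommGroup M] [Module A M] [Module k M] [IsScalarTower k A M]
    [Module.IsTorsionFree A M] (D : Derivation k A M) (B : Subalgebra k A)
    (hB : ∀ b ∈ B, D b = 0) {a : A} (ha : IsAlgebraic B a) : D a = 0 := by
  have hchar : CharZero B := charZero_of_injective_algebraMap (algebraMap k B).injective
  suffices H : ∀ n (p : Polynomial B), p ≠ 0 → p.natDegree < n → Polynomial.aeval a p = 0 →
      D a = 0 by
    obtain ⟨p, hp, h0⟩ := ha
    exact H _ p hp (Nat.lt_succ_self _) h0
  have chain (p : Polynomial B) :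
      D (Polynomial.aeval a p) = Polynomial.aeval a (Polynomial.derivative p) • D a := by
    induction p using Polynomial.induction_on' with
    | add p q hp hq => simp [hp, hq, add_smul]
    | monomial m b =>
      have hb : D (b : A) = 0 := hB _ b.2
      simp [Polynomial.aeval_monomial, Derivation.leibniz, Derivation.leibniz_pow, hb,
        Polynomial.derivative_monomial, smul_smul, mul_assoc, ← Nat.cast_smul_eq_nsmul A]
  intro n
  induction n with
  | zero => intro p _ hp; omega
  | succ n ih =>
    intro p hp hn h0
    have h1 := chain p
    rw [h0, map_zero, eq_comm, smul_eq_zero] at h1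
    refine h1.elim (fun h2 => ?_) id
    by_cases h3 : Polynomial.derivative p = 0
    · rw [Polynomial.eq_C_of_derivative_eq_zero h3, Polynomial.aeval_C] at h0
      have h4 : p.coeff 0 = 0 := Subtype.val_injective h0
      exact absurd (by rw [Polynomial.eq_C_of_derivative_eq_zero h3, h4, Polynomial.C_0]) hp
    · have h4 : p.natDegree ≠ 0 := fun h => h3 (Polynomial.derivative_of_natDegree_zero h)
      exact ih _ h3 (by have := Polynomial.natDegree_derivative_lt h4; omega) h2

end Derivation

/-! ### Rank and nonvanishing minors -/

section Minors

/-- A matrix over a field with linearly independent rows has a nonvanishing maximal minor. -/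
theorem exists_det_submatrix_ne_zero {K m n : Type*} [Field K] [Fintype m] [DecidableEq m]
    [Fintype n] (M : Matrix m n K) (hM : LinearIndependent K M.row) :
    ∃ c : m → n, (M.submatrix id c).det ≠ 0 := by
  -- A basis of the column space chosen among the columns; row rank equals column rank, so it has as
  -- many members as there are rows.
  obtain ⟨κ, a, ha, hspan, hli⟩ := exists_linearIndependent' K M.col
  have : Fintype κ := Fintype.ofInjective a ha
  have hcard : Fintype.card κ = Fintype.card m := by
    rw [← hM.rank_matrix, Matrix.rank_eq_finrank_span_cols, ← hspan, finrank_span_eq_card hli]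
  let e : m ≃ κ := Fintype.equivOfCardEq hcard.symm
  refine ⟨a ∘ e, fun h0 => ?_⟩
  rw [← Matrix.det_transpose] at h0
  obtain ⟨v, hv, hv0⟩ := Matrix.exists_vecMul_eq_zero_iff.2 h0
  refine hv (funext fun i => ?_)
  refine Fintype.linearIndependent_iff.1 (hli.comp e e.injective) v ?_ i
  ext j
  simpa [Matrix.vecMul, dotProduct] using congrFun hv0 j

/-- A nonvanishing minor of size equal to the rank. -/
theorem exists_det_submatrix_rank_ne_zero {K m n : Type*} [Field K] [Fintype m] [Fintype n]
    (M : Matrix m n K) :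
    ∃ (a : Fin M.rank → m) (c : Fin M.rank → n), (M.submatrix a c).det ≠ 0 := by
  obtain ⟨κ, a, ha, hspan, hli⟩ := exists_linearIndependent' K M.row
  have : Fintype κ := Fintype.ofInjective a ha
  have hcard : Fintype.card κ = M.rank := by
    rw [Matrix.rank_eq_finrank_span_row, ← hspan, finrank_span_eq_card hli]
  let e : Fin M.rank ≃ κ := (Fintype.equivFinOfCardEq hcard).symm
  obtain ⟨c, hc⟩ := exists_det_submatrix_ne_zero (M.submatrix (a ∘ e) id)
    (hli.comp e e.injective)
  exact ⟨a ∘ e, c, hc⟩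

theorem card_le_rank_of_det_submatrix_ne_zero {K m n κ : Type*} [Field K] [Fintype n]
    [Fintype κ] [DecidableEq κ] (M : Matrix m n K) (a : κ → m) (c : κ → n)
    (h : (M.submatrix a c).det ≠ 0) : Fintype.card κ ≤ M.rank := by
  rw [← Matrix.rank_of_det_ne_zero h]
  exact M.rank_submatrix_le a c

end Minors

/-- Algebraically independent polynomials in characteristic zero have a Jacobian matrix with a
nonvanishing maximal minor. -/
theorem exists_det_pderiv_ne_zero_of_algebraicIndependent {k : Type*} [Field k] [CharZero k]
    {σ κ : Type*} [Fintype σ] [Fintype κ] [DecidableEq κ] (f : κ → MvPolynomial σ k)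
    (hf : AlgebraicIndependent k f) :
    ∃ c : κ → σ, (Matrix.of fun a b => pderiv (c b) (f a)).det ≠ 0 := by
  classical
  -- Enlarging `f` to a transcendence basis makes the Jacobian square.
  obtain ⟨t, hst, ht⟩ := exists_isTranscendenceBasis_superset hf.to_subtype_range
  have hcard := ht.lift_cardinalMk_eq_trdeg
  rw [MvPolynomial.trdeg_of_isDomain] at hcard
  obtain ⟨e⟩ : Nonempty (t ≃ σ) := by
    refine Cardinal.lift_mk_eq'.1 ?_
    simpa using hcard
  have : Fintype t := Fintype.ofEquiv σ e.symm
  let N : Matrix t t (MvPolynomial σ k) :=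
    Matrix.of fun a b => pderiv (e b) (a : MvPolynomial σ k)
  have hN : N.det ≠ 0 := by
    intro h0
    obtain ⟨v, hv, hv0⟩ := Matrix.exists_mulVec_eq_zero_iff.2 h0
    -- A kernel vector is a derivation that vanishes on `t`, hence on everything algebraic over it,
    -- including all variables; so `v = 0`.
    let D : Derivation k (MvPolynomial σ k) (MvPolynomial σ k) := mkDerivation k (v ∘ e.symm)
    have hD (p : MvPolynomial σ k) : D p = ∑ j : t, pderiv (e j) p * v j := by
      have := derivation_aeval D X p
      rw [aeval_X_left_apply] at this
      rw [this, ← Equiv.sum_comp e]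
      simp [D, mkDerivation_X]
    have hDt (b : MvPolynomial σ k) (hb : b ∈ Algebra.adjoin k (Set.range ((↑) : t → _))) :
        D b = 0 := by
      refine Derivation.eqOn_adjoin (D1 := D) (D2 := 0) ?_ hb
      rintro _ ⟨a, rfl⟩
      rw [hD]
      simpa [Matrix.mulVec, dotProduct, N] using congrFun hv0 a
    have halg := ht.isAlgebraic
    refine hv (funext fun j => ?_)
    have := derivation_eq_zero_of_isAlgebraic D _ hDt (halg.isAlgebraic (X (e j)))
    simpa [D, mkDerivation_X] using this
  have hrows := Matrix.linearIndependent_rows_of_det_ne_zero hN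
  let g : κ → t := fun i => ⟨f i, hst ⟨i, rfl⟩⟩
  have hg : Function.Injective g := fun i j hij => hf.injective (congrArg Subtype.val hij)
  have hrows' := hrows.comp g hg
  -- Choosing columns needs a field; the resulting minor comes from the polynomial ring.
  let K := FractionRing (MvPolynomial σ k)
  let M : Matrix κ t K := Matrix.of fun i j => algebraMap _ K (N (g i) j)
  have hM : LinearIndependent K M.row := by
    rw [← LinearIndependent.iff_fractionRing (R := MvPolynomial σ k)]
    let φ : (t → MvPolynomial σ k) →ₗ[MvPolynomial σ k] (t → K) :=
      (Algebra.linearMap (MvPolynomial σ k) K).compLeft t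
    refine hrows'.map' φ ?_
    rw [LinearMap.ker_eq_bot]
    intro x y hxy
    exact funext fun j => IsFractionRing.injective (MvPolynomial σ k) K (congrFun hxy j)
  obtain ⟨c, hc⟩ := exists_det_submatrix_ne_zero M hM
  refine ⟨e ∘ c, fun h0 => hc ?_⟩
  have : M.submatrix id c = (algebraMap (MvPolynomial σ k) K).mapMatrix
      (Matrix.of fun a b => pderiv ((e ∘ c) b) (f a)) := by
    ext; rfl
  rw [this, ← RingHom.map_det, h0, map_zero]

end PolyNet

namespace PolyNet

open MvPolynomial

/-! ### Rank and image dimension for polynomial maps -/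

section PolynomialMap

variable {σ ι : Type*}

/-- The map `ℝ^σ → ℝ^ι` with the given polynomial components. -/
noncomputable def polyMap (F : ι → MvPolynomial σ ℝ) (θ : σ → ℝ) : ι → ℝ := fun j => eval θ (F j)

/-- The matrix of partial derivatives of a polynomial map at a point. -/
noncomputable def polyJacobian (F : ι → MvPolynomial σ ℝ) (θ : σ → ℝ) : Matrix ι σ ℝ :=
  Matrix.of fun j e => eval θ (pderiv e (F j))

theorem hasDerivAt_eval_update [DecidableEq σ] (p : MvPolynomial σ ℝ) (θ : σ → ℝ) (e : σ) :
    HasDerivAt (fun t : ℝ => eval (Function.update θ e t) p) (eval θ (pderiv e p)) (θ e) := by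
  induction p using MvPolynomial.induction_on with
  | C a => simpa using hasDerivAt_const (θ e) a
  | add p q hp hq => simpa only [map_add] using hp.fun_add hq
  | mul_X p i hp =>
    have hX : HasDerivAt (fun t : ℝ => Function.update θ e t i) ((Pi.single e 1 : σ → ℝ) i)
        (θ e) := hasDerivAt_pi.1 (hasDerivAt_update θ e (θ e)) i
    have := hp.mul hX
    simp only [Function.update_eq_self] at this
    convert! this using 1
    · ext t; simp
    · rw [pderiv_mul, map_add, map_mul, map_mul, eval_X, pderiv_X]
      congr 2
      by_cases h : i = e
      · subst h; simp
      · simp [h]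

theorem vanishingIdeal_zariskiClosure (S : Set (ι → ℝ)) :
    vanishingIdeal ℝ (zariskiClosure S) = vanishingIdeal ℝ S := by
  apply le_antisymm
  · exact vanishingIdeal_anti_mono fun x hx T hT => hT.2 hx
  · intro p hp x hx
    have := hx {y | ∀ q ∈ ({p} : Set (MvPolynomial ι ℝ)), eval y q = 0} ⟨⟨{p}, rfl⟩, by
      intro y hy q hq
      rw [Set.mem_singleton_iff.1 hq]
      exact hp y hy⟩
    exact this p rfl

/-- Since `ℝ` is infinite, `p ∘ F` vanishes at all points only if it is the zero polynomial. -/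
theorem vanishingIdeal_range_polyMap (F : ι → MvPolynomial σ ℝ) :
    vanishingIdeal ℝ (Set.range (polyMap F)) = RingHom.ker (aeval F : MvPolynomial ι ℝ →ₐ[ℝ] _) := by
  have key (θ : σ → ℝ) (p : MvPolynomial ι ℝ) :
      aeval (polyMap F θ) p = eval θ (aeval F p) := by
    have := DFunLike.congr_fun (comp_aeval F (aeval (R := ℝ) θ)) p
    exact this.symm
  ext p
  rw [mem_vanishingIdeal_iff, RingHom.mem_ker, Set.forall_mem_range]
  refine ⟨fun h => MvPolynomial.funext fun θ => ?_, fun h θ => ?_⟩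
  · rw [map_zero]
    exact (key θ p).symm.trans (h θ)
  · rw [key, h, map_zero]

/-- The dimension of a finitely generated domain is the largest number of algebraically
independent generators. -/
theorem exists_ringKrullDim_eq_of_adjoin_range_eq_top {k A : Type*} [Field k] [CommRing A]
    [IsDomain A] [Algebra k A] [Finite ι] (x : ι → A) (hx : Algebra.adjoin k (Set.range x) = ⊤) :
    ∃ n : ℕ, ringKrullDim A = n ∧
      (∀ (m : ℕ) (a : Fin m → ι), AlgebraicIndependent k (x ∘ a) → m ≤ n) ∧
      ∃ a : Fin n → ι, AlgebraicIndependent k (x ∘ a) := by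
  have : Algebra.FiniteType k A :=
    ⟨⟨(Set.finite_range x).toFinset, by rwa [Set.Finite.coe_toFinset]⟩⟩
  obtain ⟨n, hn, htr⟩ := exists_ringKrullDim_eq_and_trdeg_eq k A
  refine ⟨n, hn, fun m a ha => ?_, ?_⟩
  · simpa [htr] using ha.lift_cardinalMk_le_trdeg
  · have halg : Algebra.IsAlgebraic (Algebra.adjoin k (Set.range x)) A := by
      refine ⟨fun y => isAlgebraic_algebraMap (⟨y, ?_⟩ : Algebra.adjoin k (Set.range x))⟩
      rw [hx]
      trivial
    obtain ⟨t, hts, ht⟩ := exists_isTranscendenceBasis_subset (R := k) (Set.range x)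
    have hcard := ht.cardinalMk_eq_trdeg
    rw [htr] at hcard
    obtain ⟨e⟩ : Nonempty (Fin n ≃ t) := by
      refine Cardinal.lift_mk_eq'.1 ?_
      simp [hcard]
    choose a ha using fun y : t => hts y.2
    refine ⟨a ∘ e, ?_⟩
    have h1 : x ∘ (a ∘ e) = ((↑) : t → A) ∘ e := funext fun i => ha (e i)
    rw [h1]
    exact ht.1.comp e e.injective

/-- The dimension of the Zariski closure of the image of a polynomial map is the largest number
of algebraically independent components. -/
theorem exists_algDim_zariskiClosure_range_polyMap [Finite ι] (F : ι → MvPolynomial σ ℝ) :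
    ∃ n : ℕ, algDim (zariskiClosure (Set.range (polyMap F))) = n ∧
      (∀ (m : ℕ) (a : Fin m → ι), AlgebraicIndependent ℝ (F ∘ a) → m ≤ n) ∧
      ∃ a : Fin n → ι, AlgebraicIndependent ℝ (F ∘ a) := by
  let φ : MvPolynomial ι ℝ →ₐ[ℝ] MvPolynomial σ ℝ := aeval F
  let x : ι → φ.range := fun j => ⟨F j, X j, aeval_X F j⟩
  have hx (m : ℕ) (a : Fin m → ι) :
      AlgebraicIndependent ℝ (x ∘ a) ↔ AlgebraicIndependent ℝ (F ∘ a) :=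
    (φ.range.val.algebraicIndependent_iff Subtype.val_injective (x := x ∘ a)).symm
  have hadj : Algebra.adjoin ℝ (Set.range x) = ⊤ := by
    have := congrArg (Subalgebra.map φ.rangeRestrict) (adjoin_range_X (R := ℝ) (σ := ι))
    rw [AlgHom.map_adjoin, ← Set.range_comp, Algebra.map_top,
      (AlgHom.range_eq_top _).2 φ.rangeRestrict_surjective] at this
    rw [← this]
    congr 2
    exact funext fun j => Subtype.ext (aeval_X F j).symm
  obtain ⟨n, hn, hmax, a, ha⟩ := exists_ringKrullDim_eq_of_adjoin_range_eq_top x hadj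
  refine ⟨n, ?_, fun m a ha => hmax m a ((hx m a).2 ha), a, (hx n a).1 ha⟩
  rw [algDim, vanishingIdeal_zariskiClosure, vanishingIdeal_range_polyMap, ← hn]
  exact ringKrullDim_eq_of_ringEquiv (RingHom.quotientKerEquivRange φ.toRingHom)

theorem polyJacobian_submatrix_det {κ : Type*} [Fintype κ] [DecidableEq κ]
    (F : ι → MvPolynomial σ ℝ) (θ : σ → ℝ) (a : κ → ι) (c : κ → σ) :
    ((polyJacobian F θ).submatrix a c).det =
      eval θ (Matrix.of fun i j => pderiv (c j) ((F ∘ a) i)).det := by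
  rw [RingHom.map_det]
  rfl

theorem rank_polyJacobian_le_and_generic_eq [Fintype σ] [Fintype ι]
    (F : ι → MvPolynomial σ ℝ) :
    (∀ θ, ((polyJacobian F θ).rank : WithBot ℕ∞) ≤
      algDim (zariskiClosure (Set.range (polyMap F)))) ∧
    ∃ U : Set (σ → ℝ), IsZariskiOpen U ∧ U.Nonempty ∧
      ∀ θ ∈ U, ((polyJacobian F θ).rank : WithBot ℕ∞) =
        algDim (zariskiClosure (Set.range (polyMap F))) := by
  obtain ⟨n, hn, hmax, a, ha⟩ := exists_algDim_zariskiClosure_range_polyMap F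
  have hle (θ : σ → ℝ) : (polyJacobian F θ).rank ≤ n := by
    obtain ⟨b, c, hdet⟩ := exists_det_submatrix_rank_ne_zero (polyJacobian F θ)
    refine hmax _ b (algebraicIndependent_of_det_pderiv_ne_zero _ c fun h0 => hdet ?_)
    rw [polyJacobian_submatrix_det, h0, map_zero]
  rw [hn]
  refine ⟨fun θ => by exact_mod_cast hle θ, ?_⟩
  obtain ⟨c, hc⟩ := exists_det_pderiv_ne_zero_of_algebraicIndependent _ ha
  -- `U` is the locus where this minor is nonzero; it is nonempty because a nonzero real polynomial
  -- has a nonzero value.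
  set q := (Matrix.of fun i j => pderiv (c j) ((F ∘ a) i)).det with hq
  refine ⟨{θ | eval θ q ≠ 0}, ⟨{q}, ?_⟩, ?_, fun θ hθ => ?_⟩
  · ext θ
    simp
  · by_contra hempty
    refine hc (MvPolynomial.funext fun θ => ?_)
    rw [map_zero]
    by_contra hθ
    exact hempty ⟨θ, hθ⟩
  · have hge : n ≤ (polyJacobian F θ).rank := by
      have := card_le_rank_of_det_submatrix_ne_zero (polyJacobian F θ) a c (by
        rw [polyJacobian_submatrix_det]
        exact hθ)
      rwa [Fintype.card_fin] at this
    exact_mod_cast le_antisymm (hle θ) hge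

end PolynomialMap

/-! ### Network coefficients as polynomials in the weights -/

section Network

variable {h : ℕ} (d : Fin (h + 1) → ℕ) (r : ℕ)

/-- The layers of the network whose weights are indeterminates. -/
noncomputable def genericLayer :
    (i : Fin (h + 1)) → Fin (d i) → MvPolynomial (Fin (d 0)) (MvPolynomial (WeightIndex d) ℝ) :=
  Fin.induction
    (motive := fun i => Fin (d i) → MvPolynomial (Fin (d 0)) (MvPolynomial (WeightIndex d) ℝ))
    (fun a => X a)
    (fun i z => (Matrix.of fun a b => C (X ⟨i, a, b⟩)).mulVec
      (if (i : ℕ) = 0 then z else activation r z))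

/-- Specialising the indeterminate weights commutes with each layer, so `coeffPoly` evaluates to the
coefficients of the network. -/
theorem map_genericLayer (θ : Params d) (i : Fin (h + 1)) (a : Fin (d i)) :
    map (eval θ) (genericLayer d r i a) = layer r θ i a := by
  induction i using Fin.induction with
  | zero => simp [genericLayer, layer]
  | succ i ih =>
    have h1 : genericLayer d r i.succ = (Matrix.of fun a b => C (X ⟨i, a, b⟩)).mulVec
        (if (i : ℕ) = 0 then genericLayer d r i.castSucc
          else activation r (genericLayer d r i.castSucc)) := by
      simp [genericLayer]
    have h2 : layer r θ i.succ = ((weight θ i).map C).mulVec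
        (if (i : ℕ) = 0 then layer r θ i.castSucc
          else activation r (layer r θ i.castSucc)) := by
      simp [layer]
    rw [h1, h2]
    simp only [Matrix.mulVec, dotProduct, map_sum, map_mul, Matrix.of_apply, map_C, eval_X,
      Matrix.map_apply, weight]
    refine Finset.sum_congr rfl fun b _ => ?_
    congr 1
    split_ifs
    · exact ih b
    · simp [activation, ih b]

/-- The coefficients of the network as polynomials in the weights. -/
noncomputable def coeffPoly (j : CoordIndex d r) : MvPolynomial (WeightIndex d) ℝ :=
  coeff (j.2 : Fin (d 0) →₀ ℕ) (genericLayer d r (Fin.last h) j.1)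

theorem polyMap_coeffPoly (θ : Params d) :
    polyMap (coeffPoly d r) θ = ambientCoords d r (Phi d r θ) := by
  ext j
  change eval θ (coeff _ (genericLayer d r (Fin.last h) j.1)) = coeff _ (layer r θ (Fin.last h) j.1)
  rw [← map_genericLayer, coeff_map]

theorem functionalVariety_eq :
    functionalVariety d r = zariskiClosure (Set.range (polyMap (coeffPoly d r))) := by
  rw [functionalVariety, functionalSpace, ← Set.range_comp]
  congr 2
  exact funext fun θ => (polyMap_coeffPoly d r θ).symm

theorem jacobian_eq (θ : Params d) : jacobian d r θ = polyJacobian (coeffPoly d r) θ := by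
  ext j e
  simp only [jacobian, Matrix.of_apply, ← polyMap_coeffPoly]
  exact (hasDerivAt_eval_update (coeffPoly d r j) θ e).deriv

end Network

end PolyNet

theorem mainTheorem8 (h : ℕ) (hh : 1 ≤ h) (d : Fin (h + 1) → ℕ) (r : ℕ) :
    (∀ θ : PolyNet.Params d,
      ((PolyNet.jacobian d r θ).rank : WithBot ℕ∞) ≤
        PolyNet.algDim (PolyNet.functionalVariety d r)) ∧
    ∃ U : Set (PolyNet.Params d), PolyNet.IsZariskiOpen U ∧ U.Nonempty ∧
      ∀ θ ∈ U, ((PolyNet.jacobian d r θ).rank : WithBot ℕ∞) =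
        PolyNet.algDim (PolyNet.functionalVariety d r) := by
  simp only [PolyNet.jacobian_eq, PolyNet.functionalVariety_eq]
  exact PolyNet.rank_polyJacobian_le_and_generic_eq (PolyNet.coeffPoly d r)
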